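/- A Banach space over $\mathbb{R}$ is said to have the Daugavet property if $\|I+T\| = 1+\|T\|$ for every bounded linear operator $T$ of rank one from the space to itself, where $I$ is the identity operator. A subspace $X$ of a real Banach space $Y$ is called an almost isometric ideal (ai-ideal) in $Y$ if for every $\varepsilon>0$ and every finite-dimensional subspace $E$ of $Y$ there exists a linear operator $T:E\to X$ such that $Te=e$ for all $e\in E\cap X$ and $(1-\varepsilon)\|e\|\le\|Te\|\le(1+\varepsilon)\|e\|$ for all $e\in E$. Let $Y$ be a real Banach space. Then $Y$ has the Daugavet property if and only if every closed separable subspace $X$ of $Y$ which is an ai-ideal in $Y$ has the Daugavet property. -/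

import Mathlib

/-- A real normed space `Y` has the Daugavet property if `‖I + T‖ = 1 + ‖T‖` for every bounded
linear operator `T : Y → Y` of rank one. -/
def DaugavetProperty (Y : Type*) [NormedAddCommGroup Y] [NormedSpace ℝ Y] : Prop :=
  ∀ T : Y →L[ℝ] Y, (T : Y →ₗ[ℝ] Y).rank = 1 →
    ‖ContinuousLinearMap.id ℝ Y + T‖ = 1 + ‖T‖

/-- A subspace `X` of `Y` is an almost isometric ideal if for every `ε > 0` and every
finite-dimensional subspace `E` of `Y` there is a linear operator `T : E → X` which fixes
`E ∩ X` pointwise and satisfies `(1 - ε)‖e‖ ≤ ‖T e‖ ≤ (1 + ε)‖e‖` on `E`. -/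
def IsAlmostIsometricIdeal {Y : Type*} [NormedAddCommGroup Y] [NormedSpace ℝ Y]
    (X : Submodule ℝ Y) : Prop :=
  ∀ ε : ℝ, 0 < ε → ∀ E : Submodule ℝ Y, FiniteDimensional ℝ E →
    ∃ T : E →ₗ[ℝ] X,
      (∀ e : E, (e : Y) ∈ X → (T e : Y) = (e : Y)) ∧
      ∀ e : E, (1 - ε) * ‖e‖ ≤ ‖T e‖ ∧ ‖T e‖ ≤ (1 + ε) * ‖e‖

/-! By `daugavetProperty_iff_slices`, the Daugavet property says that every slice of the unit ball
given by a norm-one functional contains points almost at distance 2 from `-y`, for each unit vector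
`y`. One functional and one vector are involved, so the property can be moved between `Y` and a
subspace. Downwards, a functional on an ai-ideal `X` extends to `Y` as an ultrafilter limit of its
compositions with the local maps `T : E → X`. A slice point found in `Y` is carried into `X` by one
such `T` and rescaled. Upwards, `y` and a norming sequence for `φ` lie in a closed separable
ai-ideal `X`; then `φ` restricted to `X` still has norm one, and a slice point in `X` serves in `Y`.
Such an `X` comes from a Löwenheim–Skolem closure, based on separability of `C(K, ℝ)`. -/

open Filter Topology

/-! ### Slices and the Daugavet property. -/

/-- Rank-one operators on a real normed space have the form `x ↦ φ x • y` with `‖y‖ = 1`. -/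
theorem exists_functional_of_rank_eq_one {Y : Type*} [NormedAddCommGroup Y] [NormedSpace ℝ Y]
    (T : Y →L[ℝ] Y) (hT : (T : Y →ₗ[ℝ] Y).rank = 1) :
    ∃ (φ : Y →L[ℝ] ℝ) (y : Y), ‖y‖ = 1 ∧ φ ≠ 0 ∧ ∀ x, T x = φ x • y := by
  obtain ⟨v, hv, hv0, hle⟩ := (rank_submodule_eq_one_iff _).1 hT
  have hn : ‖v‖ ≠ 0 := norm_ne_zero_iff.2 hv0
  obtain ⟨g, -, hgv⟩ := exists_dual_vector ℝ v hn
  have hgv' : g v = ‖v‖ := by simpa using hgv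
  have hform : ∀ x, T x = (g.comp T) x • (‖v‖⁻¹ • v) := by
    intro x
    obtain ⟨c, hc⟩ := Submodule.mem_span_singleton.1
      (hle (LinearMap.mem_range_self (T : Y →ₗ[ℝ] Y) x))
    have hc' : T x = c • v := hc.symm
    rw [ContinuousLinearMap.comp_apply, hc', map_smul, hgv', smul_eq_mul, smul_smul,
      mul_assoc, mul_inv_cancel₀ hn, mul_one]
  refine ⟨g.comp T, ‖v‖⁻¹ • v, ?_, ?_, hform⟩
  · rw [norm_smul, norm_inv, norm_norm, inv_mul_cancel₀ hn]
  · intro h0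
    obtain ⟨x, hx⟩ := hv
    apply hv0
    rw [← hx]
    simpa [h0] using hform x

theorem norm_smulRight_of_norm_eq_one {Y : Type*} [NormedAddCommGroup Y] [NormedSpace ℝ Y]
    (φ : Y →L[ℝ] ℝ) {y : Y} (hy : ‖y‖ = 1) : ‖φ.smulRight y‖ = ‖φ‖ := by
  rw [ContinuousLinearMap.norm_smulRight_apply, hy, mul_one]

/-- If `x` and `y` in the unit ball almost satisfy `‖x + y‖ = 2`, then `‖x + c • y‖` is almost
`1 + c`. -/
theorem one_add_sub_lt_norm_add_smul {Y : Type*} [NormedAddCommGroup Y] [NormedSpace ℝ Y]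
    {x y : Y} (hx : ‖x‖ ≤ 1) (hy : ‖y‖ ≤ 1) {ε c : ℝ} (hε : 0 < ε) (hc : 0 < c)
    (h : 2 - ε < ‖x + y‖) : 1 + c - (1 + c) * ε < ‖x + c • y‖ := by
  rcases le_total 1 c with h1 | h1
  · have e : c • (x + y) = (x + c • y) + (c - 1) • x := by module
    have h2 := norm_add_le (x + c • y) ((c - 1) • x)
    rw [← e, norm_smul, norm_smul, Real.norm_of_nonneg hc.le,
      Real.norm_of_nonneg (sub_nonneg.2 h1)] at h2
    nlinarith [mul_lt_mul_of_pos_left h hc, mul_le_mul_of_nonneg_left hx (sub_nonneg.2 h1)]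
  · have e : x + y = (x + c • y) + (1 - c) • y := by module
    have h2 := norm_add_le (x + c • y) ((1 - c) • y)
    rw [← e, norm_smul, Real.norm_of_nonneg (sub_nonneg.2 h1)] at h2
    nlinarith [mul_le_mul_of_nonneg_left hy (sub_nonneg.2 h1), mul_pos hc hε]

/-- The characterization of the Daugavet property by slices of the unit ball. -/
theorem daugavetProperty_iff_slices {Y : Type*} [NormedAddCommGroup Y] [NormedSpace ℝ Y] :
    DaugavetProperty Y ↔ ∀ φ : Y →L[ℝ] ℝ, ‖φ‖ = 1 → ∀ y : Y, ‖y‖ = 1 → ∀ ε : ℝ, 0 < ε →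
      ∃ x : Y, ‖x‖ ≤ 1 ∧ 1 - ε < φ x ∧ 2 - ε < ‖x + y‖ := by
  constructor
  · intro hD φ hφ y hy ε hε
    have hy0 : y ≠ 0 := by rintro rfl; simp at hy
    have hφ0 : φ ≠ 0 := by rintro rfl; simp at hφ
    have hrank : ((φ.smulRight y : Y →L[ℝ] Y) : Y →ₗ[ℝ] Y).rank = 1 := by
      obtain ⟨z, hz⟩ : ∃ z, φ z ≠ 0 := by
        by_contra! h
        exact hφ0 (ContinuousLinearMap.ext h)
      refine (rank_submodule_eq_one_iff _).2 ⟨y, ⟨(φ z)⁻¹ • z, ?_⟩, hy0, ?_⟩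
      · simp [hz]
      · rintro _ ⟨x, rfl⟩
        exact Submodule.mem_span_singleton.2 ⟨φ x, rfl⟩
    have hnorm := hD (φ.smulRight y) hrank
    rw [norm_smulRight_of_norm_eq_one φ hy, hφ] at hnorm
    obtain ⟨x, hx1, hx⟩ := ContinuousLinearMap.exists_lt_apply_of_lt_opNorm
      (ContinuousLinearMap.id ℝ Y + φ.smulRight y) (r := 2 - ε / 2) (by rw [hnorm]; linarith)
    obtain ⟨u, hu1, hu0, hu⟩ : ∃ u : Y, ‖u‖ ≤ 1 ∧ 0 ≤ φ u ∧ 2 - ε / 2 < ‖u + φ u • y‖ := by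
      have hx' : 2 - ε / 2 < ‖x + φ x • y‖ := hx
      rcases le_total 0 (φ x) with h | h
      · exact ⟨x, hx1.le, h, hx'⟩
      · refine ⟨-x, by rw [norm_neg]; exact hx1.le, by simpa using h, ?_⟩
        rw [map_neg, neg_smul, ← neg_add, norm_neg]
        exact hx'
    have hφu : φ u ≤ 1 := by
      have := φ.le_opNorm u
      rw [hφ, one_mul] at this
      exact (le_abs_self _).trans (this.trans hu1)
    -- Near-maximality of `‖u + φ u • y‖` forces `φ u` close to 1, so the coefficient `φ u` can be
    -- replaced by 1.
    have h1 : ‖u + φ u • y‖ ≤ ‖u‖ + φ u := by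
      have := norm_add_le u (φ u • y)
      rwa [norm_smul, hy, mul_one, Real.norm_of_nonneg hu0] at this
    have h2 : ‖u + φ u • y‖ ≤ ‖u + y‖ + (1 - φ u) := by
      have e : u + φ u • y = (u + y) - (1 - φ u) • y := by module
      have := norm_sub_le (u + y) ((1 - φ u) • y)
      rwa [← e, norm_smul, hy, mul_one, Real.norm_of_nonneg (sub_nonneg.2 hφu)] at this
    exact ⟨u, hu1, by linarith, by linarith⟩
  · intro hS T hT
    obtain ⟨φ, y, hy, hφ0, hTx⟩ := exists_functional_of_rank_eq_one T hT
    have hTeq : T = φ.smulRight y := ContinuousLinearMap.ext hTx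
    have hTn : ‖T‖ = ‖φ‖ := by rw [hTeq, norm_smulRight_of_norm_eq_one φ hy]
    have hc : 0 < ‖φ‖ := norm_pos_iff.2 hφ0
    refine le_antisymm ?_ ?_
    · refine (norm_add_le _ _).trans ?_
      gcongr
      exact ContinuousLinearMap.norm_id_le
    rw [hTn]
    refine le_of_forall_pos_sub_le fun η hη => ?_
    set c := ‖φ‖ with hcdef
    -- The loss is `(1 + c) * ε` from rescaling `y` by `c`, plus `c * ε` from replacing `c` by `φ
    -- x`.
    have hε : 0 < η / (1 + 2 * c) := by positivity
    obtain ⟨x, hx1, hφx, hxy⟩ := hS (c⁻¹ • φ)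
      (by rw [norm_smul, norm_inv, Real.norm_of_nonneg hc.le, inv_mul_cancel₀ hc.ne'])
      y hy _ hε
    set ε := η / (1 + 2 * c) with hεdef
    have hη' : (1 + c) * ε + c * ε = η := by rw [hεdef]; field_simp; ring
    have hφx' : c * (1 - ε) < φ x := by
      have : 1 - ε < c⁻¹ * φ x := hφx
      rwa [lt_inv_mul_iff₀ hc] at this
    have hφle : φ x ≤ c := by
      have := φ.le_opNorm x
      exact (le_abs_self _).trans (this.trans (mul_le_of_le_one_right hc.le hx1))
    have h1 := one_add_sub_lt_norm_add_smul hx1 hy.le hε hc hxy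
    have h2 : ‖x + c • y‖ ≤ ‖x + φ x • y‖ + (c - φ x) := by
      have e : x + c • y = (x + φ x • y) + (c - φ x) • y := by module
      have := norm_add_le (x + φ x • y) ((c - φ x) • y)
      rwa [← e, norm_smul, hy, mul_one, Real.norm_of_nonneg (sub_nonneg.2 hφle)] at this
    have h3 : ‖x + φ x • y‖ ≤ ‖ContinuousLinearMap.id ℝ Y + T‖ := by
      have := (ContinuousLinearMap.id ℝ Y + T).le_opNorm x
      have h4 : (ContinuousLinearMap.id ℝ Y + T) x = x + φ x • y := by
        rw [← hTx]; rfl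
      rw [h4] at this
      exact this.trans (mul_le_of_le_one_right (norm_nonneg _) hx1)
    linarith

/-! ### Inheritance by almost isometric ideals. -/

set_option maxHeartbeats 1000000 in
/-- A functional on an almost isometric ideal `X` of `Y` extends to `Y` without increase of norm, in
such a way that every `y : Y` is imitated by some `z : X` which the functional almost cannot tell
from `y` and which is almost in the same position as `y` relative to a given vector of `X`. -/
theorem IsAlmostIsometricIdeal.exists_extension {Y : Type*} [NormedAddCommGroup Y]
    [NormedSpace ℝ Y] {X : Submodule ℝ Y} (hX : IsAlmostIsometricIdeal X) (f : X →L[ℝ] ℝ) :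
    ∃ F : Y →L[ℝ] ℝ, ‖F‖ ≤ ‖f‖ ∧ (∀ x : X, F x = f x) ∧
      ∀ (x : X) (y : Y) (δ : ℝ), 0 < δ → ∃ z : X, ‖z‖ ≤ (1 + δ) * ‖y‖ ∧ |f z - F y| < δ ∧
        (1 - δ) * ‖y + x‖ ≤ ‖z + x‖ := by
  classical
  have hpos : ∀ n : ℕ, (0 : ℝ) < 1 / ((n : ℝ) + 1) := fun n => Nat.one_div_pos_of_nat
  choose T hTX hTn using fun i : Finset Y × ℕ =>
    hX (1 / ((i.2 : ℝ) + 1)) (hpos i.2) (Submodule.span ℝ (i.1 : Set Y))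
      (FiniteDimensional.span_finset ℝ i.1)
  let U : Ultrafilter (Finset Y × ℕ) := Ultrafilter.of atTop
  have hU : (U : Filter (Finset Y × ℕ)) ≤ atTop := Ultrafilter.of_le atTop
  have hmem : ∀ y : Y, ∀ᶠ i in (U : Filter (Finset Y × ℕ)),
      y ∈ Submodule.span ℝ (i.1 : Set Y) := by
    intro y
    refine hU ((eventually_ge_atTop (({y} : Finset Y), 0)).mono fun i hi => ?_)
    exact Submodule.subset_span (hi.1 (Finset.mem_singleton_self y))
  have hδ : ∀ δ : ℝ, 0 < δ → ∀ᶠ i in (U : Filter (Finset Y × ℕ)), 1 / ((i.2 : ℝ) + 1) < δ := by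
    intro δ hδ
    obtain ⟨n, hn⟩ := exists_nat_one_div_lt hδ
    refine hU ((eventually_ge_atTop ((∅ : Finset Y), n)).mono fun i hi => ?_)
    exact (Nat.one_div_le_one_div hi.2).trans_lt hn
  -- The value 0 off the span is harmless: by `hmem` each `y` eventually lies in the span.
  let h : Finset Y × ℕ → Y → ℝ := fun i y =>
    if hy : y ∈ Submodule.span ℝ (i.1 : Set Y) then f (T i ⟨y, hy⟩) else 0
  have hh : ∀ i y (hy : y ∈ Submodule.span ℝ (i.1 : Set Y)), h i y = f (T i ⟨y, hy⟩) :=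
    fun i y hy => dif_pos hy
  have hbound : ∀ i y, |h i y| ≤ ‖f‖ * ((1 + 1 / ((i.2 : ℝ) + 1)) * ‖y‖) := by
    intro i y
    by_cases hy : y ∈ Submodule.span ℝ (i.1 : Set Y)
    · rw [hh i y hy]
      exact (f.le_opNorm _).trans (mul_le_mul_of_nonneg_left (hTn i ⟨y, hy⟩).2 (norm_nonneg _))
    · have : h i y = 0 := dif_neg hy
      rw [this, abs_zero]
      have := hpos i.2
      positivity
  have hlim : ∀ y, ∃ l : ℝ, Tendsto (fun i => h i y) (U : Filter (Finset Y × ℕ)) (𝓝 l) := by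
    intro y
    have hcpt : IsCompact (Set.Icc (-(‖f‖ * (2 * ‖y‖))) (‖f‖ * (2 * ‖y‖))) := isCompact_Icc
    obtain ⟨l, -, hl⟩ := hcpt.ultrafilter_le_nhds' (U.map fun i => h i y) (by
      refine Filter.Eventually.of_forall (f := (U : Filter (Finset Y × ℕ))) fun i => abs_le.1 ?_
      refine (hbound i y).trans ?_
      have h1 : 1 / ((i.2 : ℝ) + 1) ≤ 1 := by
        rw [div_le_one (by positivity)]
        linarith [(Nat.cast_nonneg i.2 : (0 : ℝ) ≤ i.2)]
      gcongr
      linarith)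
    exact ⟨l, hl⟩
  choose F hF using hlim
  have hadd : ∀ y z, F (y + z) = F y + F z := by
    intro y z
    refine tendsto_nhds_unique (hF (y + z)) (((hF y).add (hF z)).congr' ?_)
    filter_upwards [hmem y, hmem z] with i hy hz
    rw [hh i y hy, hh i z hz, hh i _ (add_mem hy hz), ← map_add, ← map_add]
    rfl
  have hsmul : ∀ (c : ℝ) y, F (c • y) = c • F y := by
    intro c y
    refine tendsto_nhds_unique (hF (c • y)) (((hF y).const_smul c).congr' ?_)
    filter_upwards [hmem y] with i hy
    rw [hh i y hy, hh i _ (Submodule.smul_mem _ c hy), ← map_smul, ← map_smul]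
    rfl
  have hFle : ∀ y, ‖F y‖ ≤ ‖f‖ * ‖y‖ := by
    intro y
    have ht : Tendsto (fun i : Finset Y × ℕ => ‖f‖ * ((1 + 1 / ((i.2 : ℝ) + 1)) * ‖y‖))
        (U : Filter (Finset Y × ℕ)) (𝓝 (‖f‖ * ((1 + 0) * ‖y‖))) := by
      refine (Tendsto.mul_const _ (Tendsto.const_add _ ?_)).const_mul _
      have : Tendsto (fun i : Finset Y × ℕ => i.2) atTop atTop := by
        rw [← prod_atTop_atTop_eq]; exact tendsto_snd
      exact (tendsto_one_div_add_atTop_nhds_zero_nat.comp this).mono_left hU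
    have := le_of_tendsto_of_tendsto' (hF y).abs ht fun i => hbound i y
    simpa using this
  let F' : Y →L[ℝ] ℝ := LinearMap.mkContinuous ⟨⟨F, hadd⟩, hsmul⟩ ‖f‖ hFle
  refine ⟨F', LinearMap.mkContinuous_norm_le _ (norm_nonneg f) hFle, fun x => ?_,
    fun x y δ hδ0 => ?_⟩
  · refine tendsto_nhds_unique (hF x) (tendsto_const_nhds.congr' ?_)
    filter_upwards [hmem x] with i hx
    rw [hh i x hx]
    congr 1
    exact Subtype.ext (hTX i ⟨x, hx⟩ x.2).symm
  · have hev := (hF y).eventually (Metric.ball_mem_nhds (F y) hδ0)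
    obtain ⟨i, hi, hx, hy, hball⟩ := ((hδ δ hδ0).and ((hmem x).and ((hmem y).and hev))).exists
    refine ⟨T i ⟨y, hy⟩, ?_, ?_, ?_⟩
    · refine (hTn i ⟨y, hy⟩).2.trans ?_
      have : ‖(⟨y, hy⟩ : Submodule.span ℝ (i.1 : Set Y))‖ = ‖y‖ := rfl
      rw [this]
      gcongr
    · rw [hh i y hy] at hball
      exact hball
    · have hTx : T i ⟨x, hx⟩ = x := Subtype.ext (hTX i ⟨x, hx⟩ x.2)
      have h1 := (hTn i (⟨y, hy⟩ + ⟨x, hx⟩)).1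
      rw [map_add, hTx] at h1
      refine le_trans ?_ h1
      have : ‖(⟨y, hy⟩ + ⟨x, hx⟩ : Submodule.span ℝ (i.1 : Set Y))‖ = ‖y + x‖ := rfl
      rw [this]
      gcongr

/-- The Daugavet property passes to almost isometric ideals. -/
theorem DaugavetProperty.of_isAlmostIsometricIdeal {Y : Type*} [NormedAddCommGroup Y]
    [NormedSpace ℝ Y] (hY : DaugavetProperty Y) {X : Submodule ℝ Y}
    (hX : IsAlmostIsometricIdeal X) : DaugavetProperty X := by
  rw [daugavetProperty_iff_slices] at hY ⊢
  intro f hf x hx ε hε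
  obtain ⟨F, hFf, hFx, happ⟩ := hX.exists_extension f
  have hF : ‖F‖ = 1 := by
    refine le_antisymm (hFf.trans_eq hf) ?_
    rw [← hf]
    refine f.opNorm_le_bound (norm_nonneg _) fun z => ?_
    rw [← hFx z]
    exact F.le_opNorm z
  obtain ⟨y, hy1, hFy, hyx⟩ := hY F hF x hx (ε / 8) (by linarith)
  -- The cap at 1 gives `δ * (1 + δ) ≤ 2 * δ`, which bounds the rescaling error of `z`.
  have hδ0 : 0 < min (ε / 8) 1 := lt_min (by linarith) one_pos
  obtain ⟨z, hz1, hfz, hzx⟩ := happ x y _ hδ0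
  set δ := min (ε / 8) 1 with hδdef
  have hδ1 : δ ≤ 1 := min_le_right _ _
  have hδε : δ ≤ ε / 8 := min_le_left _ _
  have hy2 : ‖y + x‖ ≤ 2 := (norm_add_le _ _).trans (by
    have : ‖(x : Y)‖ = 1 := hx
    linarith)
  have hz2 : ‖z‖ ≤ 1 + δ := hz1.trans (mul_le_of_le_one_right (by linarith) hy1)
  have hzx' : 2 - 3 * (ε / 8) < ‖z + x‖ := by nlinarith
  have hd : (0 : ℝ) < 1 + δ := by linarith
  obtain ⟨a, ha0, ha1, had, haδ⟩ : ∃ a : ℝ, 0 ≤ a ∧ a ≤ 1 ∧ a * (1 + δ) = 1 ∧ 1 - a ≤ δ := by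
    have h1 : (1 + δ)⁻¹ * (1 + δ) = 1 := inv_mul_cancel₀ hd.ne'
    have h2 : 0 < (1 + δ)⁻¹ := inv_pos.2 hd
    have h3 : (1 + δ)⁻¹ ≤ 1 := inv_le_one_of_one_le₀ (by linarith)
    exact ⟨(1 + δ)⁻¹, h2.le, h3, h1, by nlinarith⟩
  have hdiff : ‖(1 - a) • z‖ ≤ 2 * δ := by
    rw [norm_smul, Real.norm_of_nonneg (sub_nonneg.2 ha1)]
    nlinarith [norm_nonneg z]
  have hz : z = a • z + (1 - a) • z := by module
  refine ⟨a • z, ?_, ?_, ?_⟩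
  · rw [norm_smul, Real.norm_of_nonneg ha0, ← had]
    gcongr
  · have h1 : f z = f (a • z) + f ((1 - a) • z) := by rw [← map_add, ← hz]
    have h2 : f ((1 - a) • z) ≤ 2 * δ := by
      have := f.le_opNorm ((1 - a) • z)
      rw [hf, one_mul] at this
      exact (le_abs_self _).trans (this.trans hdiff)
    have h3 := (abs_lt.1 hfz).1
    linarith
  · have h1 : z + x = (a • z + x) + (1 - a) • z := by module
    have h2 := norm_add_le (a • z + x) ((1 - a) • z)
    rw [← h1] at h2
    linarith

/-! ### Separable almost isometric ideals containing a given separable subspace. -/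

/-- `LocallyReflected Z Z'` says that finite tuples of vectors of `Y` can be replaced by tuples of
vectors of `Z'` in almost the same position relative to a given finite tuple of vectors of `Z`. -/
def LocallyReflected {Y : Type*} [NormedAddCommGroup Y] [NormedSpace ℝ Y]
    (Z Z' : Submodule ℝ Y) : Prop :=
  ∀ (k m : ℕ) (x : Fin k → Z) (e : Fin m → Y) (δ : ℝ), 0 < δ → ∃ e' : Fin m → Z',
    ∀ p : (Fin k → ℝ) × (Fin m → ℝ),
      |‖∑ i, p.1 i • (x i : Y) + ∑ j, p.2 j • (e' j : Y)‖ -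
        ‖∑ i, p.1 i • (x i : Y) + ∑ j, p.2 j • e j‖| ≤ δ * ‖p‖

/-- `A` itself may be far from separable, as for tuples in `Y`; only the range of `G` needs a
countable dense subset. -/
theorem exists_countable_dense_image {A B : Type*} [TopologicalSpace B]
    [SecondCountableTopology B] (G : A → B) :
    ∃ S : Set A, S.Countable ∧ ∀ a, G a ∈ closure (G '' S) := by
  obtain ⟨c, hc, hd⟩ := TopologicalSpace.exists_countable_dense (Set.range G)
  choose g hg using fun b : Set.range G => b.2
  refine ⟨g '' c, hc.image g, fun a => ?_⟩
  have h1 := image_closure_subset_closure_image continuous_subtype_val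
    (Set.mem_image_of_mem Subtype.val (hd ⟨G a, a, rfl⟩))
  refine closure_mono ?_ h1
  rintro _ ⟨b, hb, rfl⟩
  exact ⟨g b, ⟨b, hb, rfl⟩, hg b⟩

theorem norm_sum_smul_sub_sum_smul_le {Y : Type*} [NormedAddCommGroup Y] [NormedSpace ℝ Y]
    {k : ℕ} (c : Fin k → ℝ) (x x' : Fin k → Y) {δ : ℝ} (h : ∀ i, ‖x i - x' i‖ ≤ δ) :
    ‖∑ i, c i • x i - ∑ i, c i • x' i‖ ≤ k * δ * ‖c‖ := by
  rw [← Finset.sum_sub_distrib]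
  refine (norm_sum_le_of_le _ (f := fun i => c i • x i - c i • x' i) (n := fun _ => ‖c‖ * δ)
    fun i _ => ?_).trans_eq ?_
  · rw [← smul_sub, norm_smul]
    exact mul_le_mul (norm_le_pi_norm c i) (h i) (norm_nonneg _) (norm_nonneg _)
  · simp; ring

/-- Passing from `x'` to a nearby tuple `x` in an almost isometric replacement. -/
theorem abs_norm_sub_norm_le_of_close {Y : Type*} [NormedAddCommGroup Y] [NormedSpace ℝ Y]
    {k m : ℕ} {x x' : Fin k → Y} {e e' : Fin m → Y} {δ η : ℝ} (h : ∀ i, ‖x i - x' i‖ ≤ η)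
    (p : (Fin k → ℝ) × (Fin m → ℝ))
    (hp : |‖∑ i, p.1 i • x' i + ∑ j, p.2 j • e' j‖ - ‖∑ i, p.1 i • x' i + ∑ j, p.2 j • e j‖|
      ≤ δ * ‖p‖) (hη : 0 ≤ η) :
    |‖∑ i, p.1 i • x i + ∑ j, p.2 j • e' j‖ - ‖∑ i, p.1 i • x i + ∑ j, p.2 j • e j‖|
      ≤ (δ + 2 * (k * η)) * ‖p‖ := by
  have h1 : ‖∑ i, p.1 i • x i - ∑ i, p.1 i • x' i‖ ≤ k * η * ‖p‖ :=
    (norm_sum_smul_sub_sum_smul_le p.1 x x' h).trans (by gcongr; exact norm_fst_le p)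
  have key : ∀ v : Y, |‖∑ i, p.1 i • x i + v‖ - ‖∑ i, p.1 i • x' i + v‖| ≤ k * η * ‖p‖ :=
    fun v => (abs_norm_sub_norm_le _ _).trans (by rwa [add_sub_add_right_eq_sub])
  have h2 := abs_le.1 (key (∑ j, p.2 j • e' j))
  have h3 := abs_le.1 (key (∑ j, p.2 j • e j))
  have h4 := abs_le.1 hp
  exact abs_le.2 ⟨by linarith, by linarith⟩

/-- A tuple matters only through its norm function on the compact unit ball of coefficients. These
functions live in the separable space `C(K, ℝ)`, so countably many pairs of tuples approximate all
of them; `C` collects the entries. -/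
theorem exists_countable_locallyReflected {Y : Type*} [NormedAddCommGroup Y] [NormedSpace ℝ Y]
    (Z : Submodule ℝ Y) [TopologicalSpace.SeparableSpace Z] (k m : ℕ) :
    ∃ C : Set Y, C.Countable ∧ ∀ (x : Fin k → Z) (e : Fin m → Y) (δ : ℝ), 0 < δ →
      ∃ e' : Fin m → Y, (∀ j, e' j ∈ C) ∧ ∀ p : (Fin k → ℝ) × (Fin m → ℝ),
        |‖∑ i, p.1 i • (x i : Y) + ∑ j, p.2 j • e' j‖ -
          ‖∑ i, p.1 i • (x i : Y) + ∑ j, p.2 j • e j‖| ≤ δ * ‖p‖ := by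
  have : SecondCountableTopology Z := UniformSpace.secondCountable_of_separable Z
  let K := Metric.closedBall (0 : (Fin k → ℝ) × (Fin m → ℝ)) 1
  have : CompactSpace K := isCompact_iff_compactSpace.1 (isCompact_closedBall _ _)
  let N : (Fin k → Z) × (Fin m → Y) → C(K, ℝ) := fun a =>
    ⟨fun p => ‖∑ i, p.1.1 i • (a.1 i : Y) + ∑ j, p.1.2 j • a.2 j‖, by fun_prop⟩
  obtain ⟨S, hS, hd⟩ := exists_countable_dense_image fun a => (a.1, N a)
  refine ⟨⋃ a ∈ S, Set.range a.2, hS.biUnion fun a _ => Set.countable_range _,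
    fun x e δ hδ => ?_⟩
  set η := δ / (1 + 2 * k) with hη
  have hη0 : 0 < η := by positivity
  obtain ⟨_, ⟨a, haS, rfl⟩, ha⟩ := Metric.mem_closure_iff.1 (hd (x, e)) η hη0
  obtain ⟨h1, h2⟩ := max_lt_iff.1 ha
  have hball : ∀ p : (Fin k → ℝ) × (Fin m → ℝ), ‖p‖ ≤ 1 →
      |‖∑ i, p.1 i • (a.1 i : Y) + ∑ j, p.2 j • a.2 j‖ -
        ‖∑ i, p.1 i • (x i : Y) + ∑ j, p.2 j • e j‖| ≤ η := by
    intro p hp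
    have := ContinuousMap.dist_apply_le_dist (f := N (x, e)) (g := N a)
      ⟨p, mem_closedBall_zero_iff.2 hp⟩
    rw [abs_sub_comm]
    exact this.trans h2.le
  have hclose : ∀ i, ‖(x i : Y) - a.1 i‖ ≤ η := fun i => by
    have := (dist_le_pi_dist x a.1 i).trans h1.le
    rwa [dist_eq_norm] at this
  refine ⟨a.2, fun j => Set.mem_biUnion haS ⟨j, rfl⟩, fun p => ?_⟩
  have hscale : |‖∑ i, p.1 i • (a.1 i : Y) + ∑ j, p.2 j • a.2 j‖ -
      ‖∑ i, p.1 i • (x i : Y) + ∑ j, p.2 j • e j‖| ≤ η * ‖p‖ := by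
    -- Both norms are homogeneous in `p`, so the estimate on the unit ball extends to all `p`.
    rcases eq_or_ne p 0 with rfl | hp
    · simp
    have hpn : 0 < ‖p‖ := norm_pos_iff.2 hp
    have h3 := hball (‖p‖⁻¹ • p)
      (by rw [norm_smul, norm_inv, norm_norm, inv_mul_cancel₀ hpn.ne'])
    simp only [Prod.smul_fst, Prod.smul_snd, Pi.smul_apply, smul_assoc, ← Finset.smul_sum,
      ← smul_add, norm_smul, norm_inv, norm_norm, ← mul_sub, abs_mul, abs_inv, abs_norm] at h3
    rwa [inv_mul_le_iff₀ hpn, mul_comm] at h3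
  have h5 : ‖∑ i, p.1 i • (x i : Y) - ∑ i, p.1 i • (a.1 i : Y)‖ ≤ k * η * ‖p‖ :=
    (norm_sum_smul_sub_sum_smul_le p.1 _ _ hclose).trans (by gcongr; exact norm_fst_le p)
  have h6 := abs_le.1 ((abs_norm_sub_norm_le (∑ i, p.1 i • (x i : Y) + ∑ j, p.2 j • a.2 j)
    (∑ i, p.1 i • (a.1 i : Y) + ∑ j, p.2 j • a.2 j)).trans
      ((congrArg norm (add_sub_add_right_eq_sub _ _ _)).trans_le h5))
  have h7 := abs_le.1 hscale
  have h8 : η * ‖p‖ + k * η * ‖p‖ ≤ δ * ‖p‖ := by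
    have h9 : (1 + k) * η ≤ δ := by
      rw [hη, mul_div_assoc', div_le_iff₀ (by positivity)]
      nlinarith [(Nat.cast_nonneg k : (0 : ℝ) ≤ k)]
    nlinarith [norm_nonneg p]
  exact abs_le.2 ⟨by linarith, by linarith⟩

theorem exists_separable_locallyReflected {Y : Type*} [NormedAddCommGroup Y] [NormedSpace ℝ Y]
    (Z : Submodule ℝ Y) (hZ : TopologicalSpace.IsSeparable (Z : Set Y)) :
    ∃ Z' : Submodule ℝ Y, TopologicalSpace.IsSeparable (Z' : Set Y) ∧ Z ≤ Z' ∧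
      LocallyReflected Z Z' := by
  have : TopologicalSpace.SeparableSpace Z := hZ.separableSpace
  choose C hC hCr using fun k m => exists_countable_locallyReflected Z k m
  refine ⟨Submodule.span ℝ (Z ∪ ⋃ k, ⋃ m, C k m), ?_, ?_, ?_⟩
  · refine TopologicalSpace.IsSeparable.span (hZ.union ?_)
    exact (Set.countable_iUnion fun k => Set.countable_iUnion fun m => hC k m).isSeparable
  · exact fun z hz => Submodule.subset_span (Or.inl hz)
  · intro k m x e δ hδ
    obtain ⟨e', he', h⟩ := hCr k m x e δ hδ
    exact ⟨fun j => ⟨e' j, Submodule.subset_span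
      (Or.inr (Set.mem_iUnion₂.2 ⟨k, m, he' j⟩))⟩, h⟩

/-- Every separable subspace is contained in a closed separable subspace that is locally
reflected in itself. -/
theorem exists_isClosed_separable_locallyReflected {Y : Type*} [NormedAddCommGroup Y]
    [NormedSpace ℝ Y] (Z : Submodule ℝ Y) (hZ : TopologicalSpace.IsSeparable (Z : Set Y)) :
    ∃ X : Submodule ℝ Y, IsClosed (X : Set Y) ∧ TopologicalSpace.IsSeparable (X : Set Y) ∧
      Z ≤ X ∧ LocallyReflected X X := by
  choose R hsep hle hrefl using
    fun W : {W : Submodule ℝ Y // TopologicalSpace.IsSeparable (W : Set Y)} =>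
      exists_separable_locallyReflected W.1 W.2
  let W : ℕ → {W : Submodule ℝ Y // TopologicalSpace.IsSeparable (W : Set Y)} :=
    fun n => Nat.rec ⟨Z, hZ⟩ (fun _ V => ⟨R V, hsep V⟩) n
  have hmono : Monotone fun n => (W n).1 := monotone_nat_of_le_succ fun n => hle (W n)
  have hcoe : ((⨆ n, (W n).1 : Submodule ℝ Y) : Set Y) = ⋃ n, ((W n).1 : Set Y) :=
    Submodule.coe_iSup_of_directed _ hmono.directed_le
  have hWX : ∀ n, (W n).1 ≤ (⨆ n, (W n).1).topologicalClosure := fun n =>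
    (le_iSup (fun n => (W n).1) n).trans (Submodule.le_topologicalClosure _)
  refine ⟨(⨆ n, (W n).1).topologicalClosure, Submodule.isClosed_topologicalClosure _, ?_,
    hWX 0, ?_⟩
  · rw [Submodule.topologicalClosure_coe, hcoe]
    exact (TopologicalSpace.IsSeparable.iUnion fun n => (W n).2).closure
  · intro k m x e δ hδ
    -- Reflection costs `δ / 2`, and moving `x` into a stage `W M` costs `2 * (k * η) ≤ δ / 2`. The
    -- reflected tuple lies one stage higher, in `W (M + 1)`.
    set η := δ / (2 * (1 + 2 * k)) with hη
    have hη0 : 0 < η := by positivity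
    have happ : ∀ i, ∃ n, ∃ y ∈ (W n).1, ‖(x i : Y) - y‖ ≤ η := by
      intro i
      have hx : (x i : Y) ∈ closure (⋃ n, ((W n).1 : Set Y)) := by
        rw [← hcoe]; exact (x i).2
      obtain ⟨y, hy, hd⟩ := Metric.mem_closure_iff.1 hx η hη0
      obtain ⟨n, hn⟩ := Set.mem_iUnion.1 hy
      exact ⟨n, y, hn, by rw [← dist_eq_norm]; exact hd.le⟩
    choose n y hy hxy using happ
    let M := Finset.univ.sup n
    have hyM : ∀ i, y i ∈ (W M).1 := fun i => hmono (Finset.le_sup (Finset.mem_univ i)) (hy i)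
    obtain ⟨e', he'⟩ := hrefl (W M) k m (fun i => ⟨y i, hyM i⟩) e (δ / 2) (half_pos hδ)
    refine ⟨fun j => ⟨e' j, hWX (M + 1) (e' j).2⟩, fun p => ?_⟩
    refine (abs_norm_sub_norm_le_of_close hxy p (he' p) hη0.le).trans ?_
    gcongr
    have h9 : k * η ≤ δ / 4 := by
      rw [hη, mul_div_assoc', div_le_iff₀ (by positivity)]
      nlinarith [(Nat.cast_nonneg k : (0 : ℝ) ≤ k)]
    linarith

/-- Split `E` as `E ∩ X` plus a complement: a basis of the first is kept fixed, and a basis of the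
second is replaced by its reflection. -/
theorem LocallyReflected.isAlmostIsometricIdeal {Y : Type*} [NormedAddCommGroup Y]
    [NormedSpace ℝ Y] {X : Submodule ℝ Y} (hX : LocallyReflected X X) :
    IsAlmostIsometricIdeal X := by
  intro ε hε E hE
  let V : Submodule ℝ E := X.comap E.subtype
  obtain ⟨W, hVW⟩ := Submodule.exists_isCompl V
  let v := Module.finBasis ℝ V
  let w := Module.finBasis ℝ W
  let Φ : E ≃ₗ[ℝ] (Fin (Module.finrank ℝ V) → ℝ) × (Fin (Module.finrank ℝ W) → ℝ) :=
    (Submodule.prodEquivOfIsCompl V W hVW).symm.trans (v.equivFun.prodCongr w.equivFun)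
  let Φc := LinearMap.toContinuousLinearMap Φ.toLinearMap
  have hΦ : ∀ u : E, ‖Φ u‖ ≤ ‖Φc‖ * ‖u‖ := fun u => Φc.le_opNorm u
  let x : Fin (Module.finrank ℝ V) → X := fun i => ⟨(v i : E), (v i).2⟩
  have hrepr : ∀ u : E, (u : Y) =
      ∑ i, (Φ u).1 i • (x i : Y) + ∑ j, (Φ u).2 j • ((w j : E) : Y) := by
    intro u
    obtain ⟨⟨a, b⟩, rfl⟩ := (Submodule.prodEquivOfIsCompl V W hVW).surjective u
    have h1 := congrArg (fun t : V => ((t : E) : Y)) (v.sum_equivFun a)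
    have h2 := congrArg (fun t : W => ((t : E) : Y)) (w.sum_equivFun b)
    simp only [Submodule.coe_sum, Submodule.coe_smul] at h1 h2
    simp only [Φ, x, LinearEquiv.trans_apply, LinearEquiv.symm_apply_apply,
      LinearEquiv.prodCongr_apply]
    rw [h1, h2]
    simp
  -- This turns an error relative to the coordinates `Φ u` into one relative to `‖u‖`; the `+ 1`
  -- covers `Φc = 0`.
  have hδ : 0 < ε / (‖Φc‖ + 1) := by positivity
  obtain ⟨e', he'⟩ := hX _ _ x (fun j => ((w j : E) : Y)) _ hδ
  let L : (Fin (Module.finrank ℝ V) → ℝ) × (Fin (Module.finrank ℝ W) → ℝ) →ₗ[ℝ] X :=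
    (Fintype.linearCombination ℝ x).coprod (Fintype.linearCombination ℝ e')
  have hL : ∀ p, (L p : Y) = ∑ i, p.1 i • (x i : Y) + ∑ j, p.2 j • (e' j : Y) := by
    intro p
    simp [L, Fintype.linearCombination_apply]
  refine ⟨L.comp Φ.toLinearMap, fun u hu => ?_, fun u => ?_⟩
  · have h0 : (Φ u).2 = 0 := by
      have : (Submodule.prodEquivOfIsCompl V W hVW).symm u = (⟨u, hu⟩, 0) :=
        Submodule.prodEquivOfIsCompl_symm_apply_left V W hVW (⟨u, hu⟩ : V)
      simp [Φ, this]
    rw [LinearMap.comp_apply, LinearEquiv.coe_coe, hL, hrepr u, h0]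
    simp
  · have h1 := he' (Φ u)
    rw [← hL, ← hrepr u] at h1
    have h2 : ε / (‖Φc‖ + 1) * ‖Φ u‖ ≤ ε * ‖u‖ := by
      rw [div_mul_eq_mul_div, div_le_iff₀ (by positivity), mul_assoc]
      refine mul_le_mul_of_nonneg_left ?_ hε.le
      nlinarith [hΦ u, norm_nonneg u]
    have h3 := abs_le.1 (h1.trans h2)
    have h4 : ‖(L.comp Φ.toLinearMap) u‖ = ‖(L (Φ u) : Y)‖ := rfl
    have h5 : ‖u‖ = ‖(u : Y)‖ := rfl
    rw [h4]
    rw [h5] at h3 ⊢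
    exact ⟨by linarith, by linarith⟩

/-! ### Separable determination and the equivalence. -/

/-- The Daugavet property is determined by the separable almost isometric ideals. -/
theorem DaugavetProperty.of_forall_separable {Y : Type*} [NormedAddCommGroup Y]
    [NormedSpace ℝ Y] (h : ∀ X : Submodule ℝ Y, IsClosed (X : Set Y) →
      TopologicalSpace.SeparableSpace X → IsAlmostIsometricIdeal X → DaugavetProperty X) :
    DaugavetProperty Y := by
  rw [daugavetProperty_iff_slices]
  intro φ hφ y hy ε hε
  have hnorming : ∀ n : ℕ, ∃ u : Y, ‖u‖ < 1 ∧ 1 - 1 / ((n : ℝ) + 1) < ‖φ u‖ := fun n =>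
    φ.exists_lt_apply_of_lt_opNorm (by
      rw [hφ]; linarith [(Nat.one_div_pos_of_nat : (0 : ℝ) < 1 / ((n : ℝ) + 1))])
  choose u hu1 hu using hnorming
  obtain ⟨X, hXc, hXs, hZX, hXr⟩ := exists_isClosed_separable_locallyReflected
    (Submodule.span ℝ (insert y (Set.range u)))
    ((Set.countable_range u).insert y).isSeparable.span
  have hmem : ∀ z ∈ insert y (Set.range u), z ∈ X := fun z hz => hZX (Submodule.subset_span hz)
  have hD := h X hXc hXs.separableSpace hXr.isAlmostIsometricIdeal
  rw [daugavetProperty_iff_slices] at hD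
  have hnorm : ‖φ.comp X.subtypeL‖ = 1 := by
    refine le_antisymm ?_ ?_
    · refine ContinuousLinearMap.opNorm_le_bound _ zero_le_one fun z => ?_
      rw [← hφ]
      exact φ.le_opNorm z
    · refine le_of_forall_pos_sub_le fun η hη => ?_
      obtain ⟨n, hn⟩ := exists_nat_one_div_lt hη
      have h1 := (φ.comp X.subtypeL).le_opNorm ⟨u n, hmem _ (Or.inr ⟨n, rfl⟩)⟩
      have h2 : ‖φ (u n)‖ ≤ ‖φ.comp X.subtypeL‖ * ‖u n‖ := h1
      have h3 := mul_le_of_le_one_right (norm_nonneg (φ.comp X.subtypeL)) (hu1 n).le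
      linarith [hu n]
  obtain ⟨x, hx1, hx2, hx3⟩ := hD _ hnorm ⟨y, hmem _ (Or.inl rfl)⟩ hy ε hε
  exact ⟨x, hx1, hx2, hx3⟩

theorem mainTheorem3 (Y : Type*) [NormedAddCommGroup Y] [NormedSpace ℝ Y] [CompleteSpace Y] :
    DaugavetProperty Y ↔
      ∀ X : Submodule ℝ Y, IsClosed (X : Set Y) → TopologicalSpace.SeparableSpace X →
        IsAlmostIsometricIdeal X → DaugavetProperty X :=
  ⟨fun hY _ _ _ hX => hY.of_isAlmostIsometricIdeal hX, DaugavetProperty.of_forall_separable⟩
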